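/- Let $s>1/2$, $L>0$ and let $\mathcal S(s,L)$ be the class of continuous probability densities $f:\mathbb R\to[0,\infty)$ with $$\int_{\mathbb R} |\mathcal F[f](\omega)|^2\,|\omega|^{2s}\,d\omega \le 2\pi L^2,\qquad \mathcal F[f](\omega)=\int_{\mathbb R} e^{i\omega x} f(x)\,dx .$$ A Markov kernel $Q$ from $\mathbb R$ to a measurable space $(\mathfrak Z,\mathscr Z)$ is called $\alpha$-private (pure local $\alpha$-differentially private) if $Q(A\mid x)\le e^{\alpha}\,Q(A\mid x')$ for all $x,x'\in\mathbb R$ and all $A\in\mathscr Z$. For every $\alpha>0$ there is a constant $C(\alpha)>0$, depending only on $\alpha$, $s$ and $L$, such that for every $t\in\mathbb R$ and every integer $n\ge 1$ $$\inf_{Q_1,\dots,Q_n,\ \widehat\ell}\ \ \sup_{f\in\mathcal S(s,L)} \mathbf E_f\big[(\widehat\ell(Z_1,\dots,Z_n)-f(t))^2\big]\ \ge\ C(\alpha)\, n^{-\frac{2s-1}{2s+1}} .$$ Here $X_1,\dots,X_n$ are i.i.d. with density $f$; given $X_1,\dots,X_n$, the private views $Z_1,\dots,Z_n$ are independent with $Z_i\sim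 Q_i(\cdot\mid X_i)$; the infimum is over all measurable spaces $\mathfrak Z_i$, all $\alpha$-private Markov kernels $Q_i$ from $\mathbb R$ to $\mathfrak Z_i$, and all measurable functions $\widehat\ell:\mathfrak Z_1\times\dots\times\mathfrak Z_n\to\mathbb R$ (estimators). -/

import Mathlib

open MeasureTheory ProbabilityTheory
open scoped ENNReal

universe u

noncomputable section

namespace PrivateDensity

/-- A Markov kernel `Q` from `𝔛` to `𝔷` provides a local `(α, β)`-differentially private view if
`Q(A | x) ≤ exp(α) Q(A | x') + β` for all `x, x'` and all measurable `A`. -/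
def IsLocallyDP {𝔛 : Type*} {𝔷 : Type*} [MeasurableSpace 𝔛] [MeasurableSpace 𝔷]
    (α β : ℝ) (Q : Kernel 𝔛 𝔷) : Prop :=
  ∀ x x' : 𝔛, ∀ A : Set 𝔷, MeasurableSet A →
    Q x A ≤ ENNReal.ofReal (Real.exp α) * Q x' A + ENNReal.ofReal β

/-- The Fourier transform `𝓕[f](ω) = ∫ exp(iωx) f(x) dx`. -/
def fourierTransform (f : ℝ → ℝ) (ω : ℝ) : ℂ :=
  ∫ x : ℝ, Complex.exp (Complex.I * ω * x) * (f x : ℂ)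

/-- The class `𝓢(s, L)` of probability densities `f` on `ℝ` with
`∫ |𝓕[f](ω)|² |ω|^{2s} dω ≤ 2πL²`. For `s > 1/2` every such density agrees almost everywhere with
exactly one continuous function; the point values `f t` are those of that version, so the elements
of the class are taken to be continuous. -/
def sobolevClass (s L : ℝ) : Set (ℝ → ℝ) :=
  {f | Continuous f ∧ (∀ x, 0 ≤ f x) ∧ Integrable f ∧ ∫ x, f x = 1 ∧
    ∫⁻ ω : ℝ, ENNReal.ofReal (‖fourierTransform f ω‖ ^ 2 * |ω| ^ (2 * s)) ≤
      ENNReal.ofReal (2 * Real.pi * L ^ 2)}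

/-- The probability measure on `ℝ` with Lebesgue density `f`: the law of one observation `X_i`. -/
def densityLaw (f : ℝ → ℝ) : Measure ℝ :=
  volume.withDensity fun x => ENNReal.ofReal (f x)

/-- The joint law of the private views `Z_1, …, Z_n`, where `X_1, …, X_n` are i.i.d. with density
`f` and, independently over `i`, `Z_i` is drawn from `Q_i(· | X_i)`. -/
def viewsLaw {n : ℕ} {𝔷 : Fin n → Type*} [∀ i, MeasurableSpace (𝔷 i)]
    (Q : ∀ i, Kernel ℝ (𝔷 i)) (f : ℝ → ℝ) : Measure (∀ i, 𝔷 i) :=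
  Measure.pi fun i => (densityLaw f).bind (Q i)

/-- The mean squared error `𝔼[(ℓ(Z_1, …, Z_n) - f(t))²]`, with values in `[0, ∞]`. -/
def meanSquaredError {n : ℕ} {𝔷 : Fin n → Type*} [∀ i, MeasurableSpace (𝔷 i)]
    (Q : ∀ i, Kernel ℝ (𝔷 i)) (ℓ : (∀ i, 𝔷 i) → ℝ) (t : ℝ) (f : ℝ → ℝ) : ℝ≥0∞ :=
  ∫⁻ z, ENNReal.ofReal ((ℓ z - f t) ^ 2) ∂(viewsLaw Q f)

/-- The private minimax risk for estimating `f t` over the class `P` from `n` observations: the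
infimum over all output spaces, all non-interactive local `(α, β)`-differentially private
mechanisms (each data holder may use a channel of his own) and all estimators based on the private
views, of the largest mean squared error over `f ∈ P`. -/
def privateMinimaxRisk (α β : ℝ) (n : ℕ) (t : ℝ) (P : Set (ℝ → ℝ)) : ℝ≥0∞ :=
  ⨅ (𝔷 : Fin n → Type u) (_ : ∀ i, MeasurableSpace (𝔷 i)) (Q : ∀ i, Kernel ℝ (𝔷 i))
    (_ : ∀ i, IsMarkovKernel (Q i)) (_ : ∀ i, IsLocallyDP α β (Q i))
    (ℓ : (∀ i, 𝔷 i) → ℝ) (_ : Measurable ℓ),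
    ⨆ f ∈ P, meanSquaredError Q ℓ t f

end PrivateDensity

end

/-! Le Cam's two-point method, with a null Gaussian density `f` of fixed variance `v` and the
mixture `(1 - ε) f + ε g`, where `g` is a Gaussian of small variance `w` and the same mean `t`.
Privacy forces the view laws under `f` and `g` to be comparable up to `exp α`, however narrow `g` is
(`IsLocallyDP.bind_le`). Hence the density of one mixture view relative to a null view has second
moment at most `1 + ε² exp α`, that of `n` views at most `exp (n ε² exp α)`, and this stays bounded
for `ε² ≍ 1 / n`.

With `p = s + 1/2`, the Sobolev energy of `ε g` is of order `ε² w ^ (-p)`, which allows `w ≍ n ^ (-1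
/ p)`. The squared gap at `t` is then of order `ε² / w ≍ n ^ (1 / p - 1)`, and `1 / p - 1 = -(2s -
1) / (2s + 1)`. -/

namespace PrivateDensity

/-! ### Two-point bound via second moments of densities -/

/-- The Cauchy–Schwarz inequality for lower Lebesgue integrals. -/
lemma sq_lintegral_mul_le {Ω : Type*} [MeasurableSpace Ω] (μ : Measure Ω) {f g : Ω → ℝ≥0∞}
    (hf : AEMeasurable f μ) (hg : AEMeasurable g μ) :
    (∫⁻ x, f x * g x ∂μ) ^ 2 ≤ (∫⁻ x, f x ^ 2 ∂μ) * ∫⁻ x, g x ^ 2 ∂μ := by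
  have h := ENNReal.lintegral_mul_le_Lp_mul_Lq μ Real.HolderConjugate.two_two hf hg
  have hsq (a : ℝ≥0∞) : (a ^ (1 / 2 : ℝ)) ^ 2 = a := by
    rw [← ENNReal.rpow_natCast, ← ENNReal.rpow_mul]
    norm_num
  simp only [ENNReal.rpow_two] at h
  calc (∫⁻ x, f x * g x ∂μ) ^ 2
      ≤ ((∫⁻ x, f x ^ 2 ∂μ) ^ (1 / 2 : ℝ) * (∫⁻ x, g x ^ 2 ∂μ) ^ (1 / 2 : ℝ)) ^ 2 := by
        gcongr
        exact h
    _ = _ := by rw [mul_pow, hsq, hsq]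

/-- Two-point lower bound: if `ν` has a density with second moment at most `K` with respect to `μ`,
no statistic estimates `a` under `μ` and `b` under `ν` with small squared error. -/
lemma two_point_lower_bound {Ω : Type*} [MeasurableSpace Ω] (μ ν : Measure Ω)
    [IsProbabilityMeasure ν] {p : Ω → ℝ≥0∞} (hp : Measurable p) (hν : ν = μ.withDensity p)
    {K R : ℝ≥0∞} (hK : ∫⁻ x, p x ^ 2 ∂μ ≤ K) {ℓ : Ω → ℝ} (hℓ : Measurable ℓ) (a b : ℝ)
    (ha : ∫⁻ x, ENNReal.ofReal ((ℓ x - a) ^ 2) ∂μ ≤ R)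
    (hb : ∫⁻ x, ENNReal.ofReal ((ℓ x - b) ^ 2) ∂ν ≤ R) :
    ENNReal.ofReal ((b - a) ^ 2) ≤ 2 * (K + 1) * R := by
  have hsq (x : ℝ) : ENNReal.ofReal |x| ^ 2 = ENNReal.ofReal (x ^ 2) := by
    rw [← ENNReal.ofReal_pow (abs_nonneg x), sq_abs]
  have hma : Measurable fun x => ENNReal.ofReal |ℓ x - a| := by fun_prop
  have hmb : Measurable fun x => ENNReal.ofReal |ℓ x - b| := by fun_prop
  -- Change of measure: the `ν`-integral is the `μ`-integral against `p`, so Cauchy–Schwarz trades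
  -- the error under `ν` for `K` times the squared error under `μ`.
  have hA : (∫⁻ x, ENNReal.ofReal |ℓ x - a| ∂ν) ^ 2 ≤ K * R := by
    rw [hν, lintegral_withDensity_eq_lintegral_mul _ hp hma]
    refine (sq_lintegral_mul_le μ hp.aemeasurable hma.aemeasurable).trans ?_
    simp only [hsq]
    gcongr
  have hB : (∫⁻ x, ENNReal.ofReal |ℓ x - b| ∂ν) ^ 2 ≤ R := by
    have := sq_lintegral_mul_le ν hmb.aemeasurable (aemeasurable_const (b := (1 : ℝ≥0∞)))
    simp only [hsq, mul_one, one_pow, lintegral_one, measure_univ] at this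
    exact this.trans hb
  have hΔ : ENNReal.ofReal |b - a| ≤
      (∫⁻ x, ENNReal.ofReal |ℓ x - a| ∂ν) + ∫⁻ x, ENNReal.ofReal |ℓ x - b| ∂ν := by
    rw [← lintegral_add_left hma]
    calc ENNReal.ofReal |b - a| = ∫⁻ _, ENNReal.ofReal |b - a| ∂ν := by simp
      _ ≤ _ := by
        refine lintegral_mono fun x => ?_
        rw [← ENNReal.ofReal_add (abs_nonneg _) (abs_nonneg _)]
        refine ENNReal.ofReal_le_ofReal ?_
        have := abs_sub (ℓ x - a) (ℓ x - b)
        rwa [sub_sub_sub_cancel_left] at this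
  rw [← hsq]
  calc ENNReal.ofReal |b - a| ^ 2
      ≤ ((∫⁻ x, ENNReal.ofReal |ℓ x - a| ∂ν) + ∫⁻ x, ENNReal.ofReal |ℓ x - b| ∂ν) ^ 2 := by
        gcongr
    _ ≤ 2 * ((∫⁻ x, ENNReal.ofReal |ℓ x - a| ∂ν) ^ 2 +
          (∫⁻ x, ENNReal.ofReal |ℓ x - b| ∂ν) ^ 2) := by
        have := ENNReal.rpow_add_le_mul_rpow_add_rpow (∫⁻ x, ENNReal.ofReal |ℓ x - a| ∂ν)
          (∫⁻ x, ENNReal.ofReal |ℓ x - b| ∂ν) one_le_two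
        norm_num at this
        exact this
    _ ≤ 2 * (K * R + R) := by gcongr
    _ = 2 * (K + 1) * R := by ring

/-! ### Densities on product spaces -/

lemma lintegral_pi_prod {ι : Type*} [Fintype ι] {Ω : ι → Type*} [∀ i, MeasurableSpace (Ω i)]
    (μ : ∀ i, Measure (Ω i)) [∀ i, IsProbabilityMeasure (μ i)] {p : ∀ i, Ω i → ℝ≥0∞}
    (hp : ∀ i, Measurable (p i)) :
    ∫⁻ z, ∏ i, p i (z i) ∂(Measure.pi μ) = ∏ i, ∫⁻ x, p i x ∂(μ i) := by
  have hind : iIndepFun (fun i (z : ∀ i, Ω i) => p i (z i)) (Measure.pi μ) :=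
    iIndepFun_pi fun i => (hp i).aemeasurable
  rw [lintegral_prod_eq_prod_lintegral_of_indepFun Finset.univ _ hind
    fun i => (hp i).comp (measurable_pi_apply i)]
  exact Finset.prod_congr rfl fun i _ =>
    (measurePreserving_eval μ i).lintegral_comp (hp i)

/-- Boxes determine the product measure, and on a box the indicator splits into coordinate factors.
-/
lemma pi_withDensity {ι : Type*} [Fintype ι] {Ω : ι → Type*} [∀ i, MeasurableSpace (Ω i)]
    (μ : ∀ i, Measure (Ω i)) [∀ i, IsProbabilityMeasure (μ i)] {p : ∀ i, Ω i → ℝ≥0∞}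
    (hp : ∀ i, Measurable (p i)) [∀ i, SigmaFinite ((μ i).withDensity (p i))] :
    Measure.pi (fun i => (μ i).withDensity (p i)) =
      (Measure.pi μ).withDensity fun z => ∏ i, p i (z i) := by
  refine Measure.pi_eq fun A hA => ?_
  rw [withDensity_apply _ (MeasurableSet.univ_pi hA),
    ← lintegral_indicator (MeasurableSet.univ_pi hA)]
  have hind : (Set.univ.pi A).indicator (fun z => ∏ i, p i (z i)) =
      fun z => ∏ i, (A i).indicator (p i) (z i) := by
    ext z
    by_cases hz : z ∈ Set.univ.pi A
    · rw [Set.indicator_of_mem hz]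
      exact Finset.prod_congr rfl fun i _ =>
        (Set.indicator_of_mem (hz i (Set.mem_univ i)) _).symm
    · rw [Set.indicator_of_notMem hz]
      simp only [Set.mem_pi, Set.mem_univ, true_implies, not_forall] at hz
      obtain ⟨i, hi⟩ := hz
      exact (Finset.prod_eq_zero (Finset.mem_univ i) (Set.indicator_of_notMem hi _)).symm
  rw [hind, lintegral_pi_prod μ fun i => (hp i).indicator (hA i)]
  exact Finset.prod_congr rfl fun i _ => by
    rw [withDensity_apply _ (hA i), lintegral_indicator (hA i)]

/-! ### Private views of mixtures -/

/-- A mixture `u μ + ε ρ` of probability measures with `ρ ≤ M μ` has a density with respect to `μ`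
whose second moment is at most `1 + ε² M`. -/
lemma exists_density_mixture {Ω : Type*} [MeasurableSpace Ω] (μ ρ : Measure Ω)
    [IsProbabilityMeasure μ] [IsProbabilityMeasure ρ] {u ε M : ℝ≥0∞} (huε : u + ε = 1)
    (hρ : ρ ≤ M • μ) :
    ∃ r : Ω → ℝ≥0∞, Measurable r ∧ u • μ + ε • ρ = μ.withDensity r ∧
      ∫⁻ x, r x ^ 2 ∂μ ≤ 1 + ε ^ 2 * M := by
  have hac : ρ ≪ μ := (Measure.absolutelyContinuous_of_le hρ).trans Measure.smul_absolutelyContinuous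
  set q := ρ.rnDeriv μ with hq
  have hqm : Measurable q := Measure.measurable_rnDeriv ρ μ
  have hqd : μ.withDensity q = ρ := Measure.withDensity_rnDeriv_eq ρ μ hac
  have hq1 : ∫⁻ x, q x ∂μ = 1 := by
    rw [← setLIntegral_univ, ← withDensity_apply _ MeasurableSet.univ, hqd, measure_univ]
  have hqM : q ≤ᵐ[μ] fun _ => M := by
    refine ae_le_of_forall_setLIntegral_le_of_sigmaFinite hqm fun A hA _ => ?_
    rw [← withDensity_apply _ hA, hqd, setLIntegral_const]
    simpa using hρ A
  -- Since `q ≤ M` and `q` has integral one, the bound is `M` rather than `M²`.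
  have hq2 : ∫⁻ x, q x ^ 2 ∂μ ≤ M := by
    calc ∫⁻ x, q x ^ 2 ∂μ ≤ ∫⁻ x, M * q x ∂μ := by
          refine lintegral_mono_ae ?_
          filter_upwards [hqM] with x hx
          rw [sq]
          gcongr
      _ = M := by rw [lintegral_const_mul _ hqm, hq1, mul_one]
  refine ⟨fun x => u + ε * q x, by fun_prop, ?_, ?_⟩
  · ext A hA
    rw [withDensity_apply _ hA, lintegral_add_left measurable_const, setLIntegral_const,
      lintegral_const_mul _ hqm, ← withDensity_apply _ hA, hqd]
    simp
  · have hexp (x : Ω) : (u + ε * q x) ^ 2 = u ^ 2 + 2 * u * ε * q x + ε ^ 2 * q x ^ 2 := by ring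
    simp only [hexp]
    rw [lintegral_add_left (by fun_prop), lintegral_add_left (by fun_prop), lintegral_const,
      lintegral_const_mul _ hqm, lintegral_const_mul _ (by fun_prop), hq1, measure_univ,
      mul_one, mul_one]
    refine add_le_add ?_ (by gcongr)
    calc u ^ 2 + 2 * u * ε ≤ u ^ 2 + 2 * u * ε + ε ^ 2 := le_self_add
      _ = (u + ε) ^ 2 := by ring
      _ = 1 := by rw [huε, one_pow]

/-- The laws of a private view under any two input laws are comparable up to `exp α`. -/
lemma IsLocallyDP.bind_le {𝔛 𝔷 : Type*} [MeasurableSpace 𝔛] [MeasurableSpace 𝔷] {α : ℝ}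
    {Q : Kernel 𝔛 𝔷} (hQ : IsLocallyDP α 0 Q) (P P' : Measure 𝔛) [IsProbabilityMeasure P]
    [IsProbabilityMeasure P'] :
    P'.bind Q ≤ ENNReal.ofReal (Real.exp α) • P.bind Q := by
  refine Measure.le_iff.2 fun A hA => ?_
  rw [Measure.smul_apply, Measure.bind_apply hA Q.aemeasurable,
    Measure.bind_apply hA Q.aemeasurable, smul_eq_mul,
    ← lintegral_const_mul _ (Q.measurable_coe hA)]
  -- Rewriting the left side as a constant averaged over `P` lets the privacy inequality act on each
  -- pair of inputs.
  calc ∫⁻ x, Q x A ∂P' = ∫⁻ _, (∫⁻ x, Q x A ∂P') ∂P := by simp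
    _ ≤ _ := by
      refine lintegral_mono fun x => ?_
      calc ∫⁻ x', Q x' A ∂P' ≤ ∫⁻ _, ENNReal.ofReal (Real.exp α) * Q x A ∂P' :=
            lintegral_mono fun x' => by simpa using hQ x' x A hA
        _ = _ := by simp

lemma bind_densityLaw_mixture {𝔷 : Type*} [MeasurableSpace 𝔷] (Q : Kernel ℝ 𝔷) {f g : ℝ → ℝ}
    (hf : Measurable f) (hg : Measurable g) (hf0 : ∀ x, 0 ≤ f x) (hg0 : ∀ x, 0 ≤ g x)
    {ε : ℝ} (hε0 : 0 ≤ ε) (hε1 : ε ≤ 1) :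
    (densityLaw fun x => (1 - ε) * f x + ε * g x).bind Q =
      ENNReal.ofReal (1 - ε) • (densityLaw f).bind Q +
        ENNReal.ofReal ε • (densityLaw g).bind Q := by
  have hlaw : (densityLaw fun x => (1 - ε) * f x + ε * g x) =
      ENNReal.ofReal (1 - ε) • densityLaw f + ENNReal.ofReal ε • densityLaw g := by
    unfold densityLaw
    rw [← withDensity_smul _ (by fun_prop), ← withDensity_smul _ (by fun_prop),
      ← withDensity_add_left (by fun_prop)]
    congr 1
    ext x
    have h1 := sub_nonneg.2 hε1
    simp only [Pi.add_apply, Pi.smul_apply, smul_eq_mul]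
    rw [ENNReal.ofReal_add (mul_nonneg h1 (hf0 x)) (mul_nonneg hε0 (hg0 x)),
      ENNReal.ofReal_mul h1, ENNReal.ofReal_mul hε0]
  ext A hA
  simp [hlaw, Measure.bind_apply hA Q.aemeasurable]

/-- Lower bound for the larger of the two mean squared errors at `f` and at a mixture
`(1 - ε) f + ε g`, from `n` private views. -/
lemma meanSquaredError_mixture_lower_bound {n : ℕ} {𝔷 : Fin n → Type*}
    [∀ i, MeasurableSpace (𝔷 i)] {α : ℝ} (Q : ∀ i, Kernel ℝ (𝔷 i)) [∀ i, IsMarkovKernel (Q i)]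
    (hQ : ∀ i, IsLocallyDP α 0 (Q i)) {ℓ : (∀ i, 𝔷 i) → ℝ} (hℓ : Measurable ℓ) (t : ℝ)
    {f g : ℝ → ℝ} (hf : Measurable f) (hg : Measurable g) (hf0 : ∀ x, 0 ≤ f x)
    (hg0 : ∀ x, 0 ≤ g x) [IsProbabilityMeasure (densityLaw f)]
    [IsProbabilityMeasure (densityLaw g)] {ε : ℝ} (hε0 : 0 ≤ ε) (hε1 : ε ≤ 1) {R : ℝ≥0∞}
    (hRf : meanSquaredError Q ℓ t f ≤ R)
    (hRm : meanSquaredError Q ℓ t (fun x => (1 - ε) * f x + ε * g x) ≤ R) :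
    ENNReal.ofReal ((ε * (g t - f t)) ^ 2) ≤
      2 * (ENNReal.ofReal (Real.exp (n * (ε ^ 2 * Real.exp α))) + 1) * R := by
  have hsum : ENNReal.ofReal (1 - ε) + ENNReal.ofReal ε = 1 := by
    rw [← ENNReal.ofReal_add (sub_nonneg.2 hε1) hε0]
    simp
  have hμ (i : Fin n) : IsProbabilityMeasure ((densityLaw f).bind (Q i)) := inferInstance
  have hρ (i : Fin n) : IsProbabilityMeasure ((densityLaw g).bind (Q i)) := inferInstance
  choose r hrm hrd hr2 using fun i => exists_density_mixture ((densityLaw f).bind (Q i))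
    ((densityLaw g).bind (Q i)) hsum
    ((hQ i).bind_le (densityLaw f) (densityLaw g))
  have hν (i : Fin n) : IsProbabilityMeasure (((densityLaw f).bind (Q i)).withDensity (r i)) := by
    rw [← hrd i]
    constructor
    simpa using hsum
  have hlaw : viewsLaw Q (fun x => (1 - ε) * f x + ε * g x) =
      Measure.pi fun i => ((densityLaw f).bind (Q i)).withDensity (r i) := by
    unfold viewsLaw
    congr 1
    ext1 i
    rw [bind_densityLaw_mixture (Q i) hf hg hf0 hg0 hε0 hε1, hrd i]
  have hprob : IsProbabilityMeasure (viewsLaw Q fun x => (1 - ε) * f x + ε * g x) := by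
    rw [hlaw]
    infer_instance
  have hprod : Measurable fun z : ∀ i, 𝔷 i => ∏ i, r i (z i) :=
    Finset.measurable_prod _ fun i _ => (hrm i).comp (measurable_pi_apply i)
  have hK : ∫⁻ z, (∏ i, r i (z i)) ^ 2 ∂(viewsLaw Q f) ≤
      ENNReal.ofReal (Real.exp (n * (ε ^ 2 * Real.exp α))) := by
    simp only [← Finset.prod_pow]
    unfold viewsLaw
    rw [lintegral_pi_prod _ fun i => (hrm i).pow_const 2]
    -- Each factor is at most `1 + ε² exp α ≤ exp (ε² exp α)`.
    calc ∏ i, ∫⁻ x, r i x ^ 2 ∂((densityLaw f).bind (Q i))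
        ≤ ∏ _i : Fin n, ENNReal.ofReal (Real.exp (ε ^ 2 * Real.exp α)) := by
          refine Finset.prod_le_prod' fun i _ => (hr2 i).trans ?_
          rw [← ENNReal.ofReal_pow hε0, ← ENNReal.ofReal_mul (by positivity), ← ENNReal.ofReal_one,
            ← ENNReal.ofReal_add zero_le_one (by positivity)]
          refine ENNReal.ofReal_le_ofReal ?_
          linarith [Real.add_one_le_exp (ε ^ 2 * Real.exp α)]
      _ = _ := by
          rw [Finset.prod_const, Finset.card_univ, Fintype.card_fin,
            ← ENNReal.ofReal_pow (Real.exp_pos _).le, ← Real.exp_nat_mul]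
  have h := two_point_lower_bound (viewsLaw Q f) _ hprod
    (hlaw.trans (pi_withDensity _ hrm)) hK hℓ (f t) ((1 - ε) * f t + ε * g t) hRf hRm
  convert h using 3
  ring

/-! ### Gaussian mixtures in the Sobolev class -/

lemma lintegral_exp_neg_mul_sq_mul_abs_rpow {s b : ℝ} (hs : 0 < s) (hb : 0 < b) :
    ∫⁻ ω : ℝ, ENNReal.ofReal (Real.exp (-b * ω ^ 2) * |ω| ^ (2 * s)) =
      ENNReal.ofReal (b ^ (-(s + 1 / 2)) * Real.Gamma (s + 1 / 2)) := by
  have hval : ∫ ω : ℝ, Real.exp (-b * ω ^ 2) * |ω| ^ (2 * s) =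
      b ^ (-(s + 1 / 2)) * Real.Gamma (s + 1 / 2) := by
    have h1 := integral_comp_abs (f := fun x : ℝ => x ^ (2 * s) * Real.exp (-b * x ^ (2 : ℝ)))
    rw [integral_rpow_mul_exp_neg_mul_rpow two_pos (by linarith) hb] at h1
    simp only [Real.rpow_two, sq_abs] at h1
    simp only [mul_comm (Real.exp _)]
    rw [h1, show -(2 * s + 1) / 2 = -(s + 1 / 2) by ring,
      show (2 * s + 1) / 2 = s + 1 / 2 by ring]
    ring
  have hpos : 0 < b ^ (-(s + 1 / 2)) * Real.Gamma (s + 1 / 2) :=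
    mul_pos (Real.rpow_pos_of_pos hb _) (Real.Gamma_pos_of_pos (by linarith))
  -- A non-integrable function has Bochner integral `0`, so the positive value yields integrability.
  rw [← hval, ofReal_integral_eq_lintegral_ofReal
    (Integrable.of_integral_ne_zero (hval ▸ hpos.ne')) (ae_of_all _ fun ω => by positivity)]

lemma fourierTransform_gaussianPDFReal (t : ℝ) {v : NNReal} (hv : v ≠ 0) (ω : ℝ) :
    fourierTransform (gaussianPDFReal t v) ω =
      Complex.exp (ω * t * Complex.I - v * ω ^ 2 / 2) := by
  rw [← charFun_gaussianReal, charFun_apply_real, integral_gaussianReal_eq_integral_smul hv]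
  refine integral_congr_ae (ae_of_all _ fun x => ?_)
  simp only [Complex.real_smul]
  rw [mul_comm, show Complex.I * ω * x = ω * x * Complex.I by ring]

lemma norm_fourierTransform_gaussianPDFReal (t : ℝ) {v : NNReal} (hv : v ≠ 0) (ω : ℝ) :
    ‖fourierTransform (gaussianPDFReal t v) ω‖ ^ 2 = Real.exp (-v * ω ^ 2) := by
  rw [fourierTransform_gaussianPDFReal t hv, Complex.norm_exp, ← Real.exp_nat_mul]
  congr 1
  have : (ω * t * Complex.I - v * ω ^ 2 / 2 : ℂ) =
      ((-(v * ω ^ 2 / 2) : ℝ) : ℂ) + ((ω * t : ℝ) : ℂ) * Complex.I := by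
    push_cast
    ring
  rw [this, Complex.add_re, Complex.re_ofReal_mul, Complex.I_re, Complex.ofReal_re]
  push_cast
  ring

lemma fourierTransform_mixture {f g : ℝ → ℝ} (hf : Integrable f) (hg : Integrable g) (ε ω : ℝ) :
    fourierTransform (fun x => (1 - ε) * f x + ε * g x) ω =
      (1 - ε) * fourierTransform f ω + ε * fourierTransform g ω := by
  have hint {h : ℝ → ℝ} (hh : Integrable h) :
      Integrable fun x : ℝ => Complex.exp (Complex.I * ω * x) * (h x : ℂ) := by
    refine hh.ofReal.bdd_mul (c := 1) (by fun_prop) (ae_of_all _ fun x => ?_)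
    rw [show Complex.I * ω * x = ((ω * x : ℝ) : ℂ) * Complex.I by push_cast; ring,
      Complex.norm_exp_ofReal_mul_I]
  unfold fourierTransform
  rw [← integral_const_mul, ← integral_const_mul,
    ← integral_add ((hint hf).const_mul _) ((hint hg).const_mul _)]
  refine integral_congr_ae (ae_of_all _ fun x => ?_)
  push_cast
  ring

lemma continuous_gaussianPDFReal (t : ℝ) (v : NNReal) : Continuous (gaussianPDFReal t v) := by
  unfold gaussianPDFReal
  fun_prop

/-- A mixture of two centred Gaussian densities lies in the Sobolev class as soon as its
variances are not too small. -/
lemma gaussian_mixture_mem_sobolevClass {s L : ℝ} (hs : 0 < s) (t : ℝ) {v w : NNReal}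
    (hv : v ≠ 0) (hw : w ≠ 0) {ε : ℝ} (hε0 : 0 ≤ ε) (hε1 : ε ≤ 1)
    (h : 2 * Real.Gamma (s + 1 / 2) *
      ((v : ℝ) ^ (-(s + 1 / 2)) + ε ^ 2 * (w : ℝ) ^ (-(s + 1 / 2))) ≤ 2 * Real.pi * L ^ 2) :
    (fun x => (1 - ε) * gaussianPDFReal t v x + ε * gaussianPDFReal t w x) ∈
      sobolevClass s L := by
  have hv' : (0 : ℝ) < v := NNReal.coe_pos.2 (pos_iff_ne_zero.2 hv)
  have hw' : (0 : ℝ) < w := NNReal.coe_pos.2 (pos_iff_ne_zero.2 hw)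
  have h1 : 0 ≤ 1 - ε := sub_nonneg.2 hε1
  have hiv := integrable_gaussianPDFReal t v
  have hiw := integrable_gaussianPDFReal t w
  refine ⟨?_, ?_, (hiv.const_mul _).add (hiw.const_mul _), ?_, ?_⟩
  · exact ((continuous_gaussianPDFReal t v).const_mul _).add
      ((continuous_gaussianPDFReal t w).const_mul _)
  · intro x
    have := gaussianPDFReal_nonneg t v x
    have := gaussianPDFReal_nonneg t w x
    positivity
  · rw [integral_add (hiv.const_mul _) (hiw.const_mul _), integral_const_mul, integral_const_mul,
      integral_gaussianPDFReal_eq_one t hv, integral_gaussianPDFReal_eq_one t hw]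
    ring
  · have hbound (ω : ℝ) :
        ‖fourierTransform (fun x => (1 - ε) * gaussianPDFReal t v x +
          ε * gaussianPDFReal t w x) ω‖ ^ 2 ≤
        2 * Real.exp (-v * ω ^ 2) + 2 * ε ^ 2 * Real.exp (-w * ω ^ 2) := by
      rw [fourierTransform_mixture hiv hiw, ← norm_fourierTransform_gaussianPDFReal t hv,
        ← norm_fourierTransform_gaussianPDFReal t hw]
      set a := fourierTransform (gaussianPDFReal t v) ω
      set b := fourierTransform (gaussianPDFReal t w) ω
      have hab : ‖(1 - ε) * a + ε * b‖ ≤ ‖a‖ + ε * ‖b‖ := by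
        refine (norm_add_le _ _).trans ?_
        have hn : ‖(1 - ε : ℂ)‖ = 1 - ε := by
          rw [← Complex.ofReal_one, ← Complex.ofReal_sub, Complex.norm_real,
            Real.norm_of_nonneg h1]
        rw [norm_mul, norm_mul, hn, Complex.norm_real, Real.norm_of_nonneg hε0]
        gcongr
        exact mul_le_of_le_one_left (norm_nonneg a) (by linarith)
      calc ‖(1 - ε) * a + ε * b‖ ^ 2 ≤ (‖a‖ + ε * ‖b‖) ^ 2 := by gcongr
        _ ≤ 2 * (‖a‖ ^ 2 + (ε * ‖b‖) ^ 2) := add_sq_le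
        _ = _ := by ring
    calc ∫⁻ ω : ℝ, ENNReal.ofReal (‖fourierTransform (fun x => (1 - ε) * gaussianPDFReal t v x +
          ε * gaussianPDFReal t w x) ω‖ ^ 2 * |ω| ^ (2 * s))
        ≤ ∫⁻ ω : ℝ, (ENNReal.ofReal 2 * ENNReal.ofReal (Real.exp (-v * ω ^ 2) * |ω| ^ (2 * s)) +
          ENNReal.ofReal (2 * ε ^ 2) *
            ENNReal.ofReal (Real.exp (-w * ω ^ 2) * |ω| ^ (2 * s))) := by
          refine lintegral_mono fun ω => ?_
          rw [← ENNReal.ofReal_mul zero_le_two, ← ENNReal.ofReal_mul (by positivity),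
            ← ENNReal.ofReal_add (by positivity) (by positivity)]
          refine ENNReal.ofReal_le_ofReal ?_
          calc _ ≤ (2 * Real.exp (-v * ω ^ 2) + 2 * ε ^ 2 * Real.exp (-w * ω ^ 2)) *
                |ω| ^ (2 * s) := by
                gcongr
                exact hbound ω
            _ = _ := by ring
      _ = ENNReal.ofReal (2 * Real.Gamma (s + 1 / 2) *
            ((v : ℝ) ^ (-(s + 1 / 2)) + ε ^ 2 * (w : ℝ) ^ (-(s + 1 / 2)))) := by
          have hΓ := Real.Gamma_pos_of_pos (show 0 < s + 1 / 2 by linarith)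
          rw [lintegral_add_left (by fun_prop), lintegral_const_mul _ (by fun_prop),
            lintegral_const_mul _ (by fun_prop), lintegral_exp_neg_mul_sq_mul_abs_rpow hs hv',
            lintegral_exp_neg_mul_sq_mul_abs_rpow hs hw', ← ENNReal.ofReal_mul zero_le_two,
            ← ENNReal.ofReal_mul (by positivity),
            ← ENNReal.ofReal_add (by positivity) (by positivity)]
          congr 1
          ring
      _ ≤ _ := ENNReal.ofReal_le_ofReal h

lemma isProbabilityMeasure_densityLaw_gaussianPDFReal (t : ℝ) {v : NNReal} (hv : v ≠ 0) :
    IsProbabilityMeasure (densityLaw (gaussianPDFReal t v)) := by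
  have : densityLaw (gaussianPDFReal t v) = gaussianReal t v :=
    (gaussianReal_of_var_ne_zero t hv).symm
  rw [this]
  infer_instance

/-- At the common mean, the gap between Gaussian densities with variances `w ≤ v / 4`. -/
lemma sq_gaussianPDFReal_sub_lower_bound (t : ℝ) {v w : NNReal} (hw : w ≠ 0)
    (hwv : 4 * w ≤ v) :
    1 / (8 * Real.pi * w) ≤ (gaussianPDFReal t w t - gaussianPDFReal t v t) ^ 2 := by
  have hw' : (0 : ℝ) < w := NNReal.coe_pos.2 (pos_iff_ne_zero.2 hw)
  have hwv' : 4 * (w : ℝ) ≤ v := by exact_mod_cast hwv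
  have hπ := Real.pi_pos
  have hval (x : NNReal) : gaussianPDFReal t x t = (√(2 * Real.pi * x))⁻¹ := by
    simp [gaussianPDFReal]
  -- The peak height scales as variance to the power `-1/2`, so a factor 4 in variance halves it.
  have hle : gaussianPDFReal t v t ≤ gaussianPDFReal t w t / 2 := by
    rw [hval, hval]
    have : 2 * √(2 * Real.pi * w) ≤ √(2 * Real.pi * v) := by
      refine Real.le_sqrt_of_sq_le ?_
      rw [mul_pow, Real.sq_sqrt (by positivity)]
      nlinarith
    calc (√(2 * Real.pi * v))⁻¹ ≤ (2 * √(2 * Real.pi * w))⁻¹ := by gcongr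
      _ = _ := by rw [mul_inv]; ring
  calc 1 / (8 * Real.pi * w) = (gaussianPDFReal t w t / 2) ^ 2 := by
        rw [hval, div_pow, inv_pow, Real.sq_sqrt (by positivity)]
        field_simp
        norm_num
    _ ≤ _ := by
        have := gaussianPDFReal_nonneg t w t
        gcongr
        linarith

/-! ### Minimax bound and choice of parameters -/

/-- Lower bound for the private minimax risk over a class containing `f` and `(1 - ε) f + ε g`. -/
lemma le_privateMinimaxRisk_of_mixture_mem {α : ℝ} {n : ℕ} (t : ℝ) {P : Set (ℝ → ℝ)}
    {f g : ℝ → ℝ} (hf : Measurable f) (hg : Measurable g) (hf0 : ∀ x, 0 ≤ f x)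
    (hg0 : ∀ x, 0 ≤ g x) [IsProbabilityMeasure (densityLaw f)]
    [IsProbabilityMeasure (densityLaw g)] {ε : ℝ} (hε0 : 0 ≤ ε) (hε1 : ε ≤ 1) (hfP : f ∈ P)
    (hmP : (fun x => (1 - ε) * f x + ε * g x) ∈ P) :
    ENNReal.ofReal ((ε * (g t - f t)) ^ 2 / (2 * (Real.exp (n * (ε ^ 2 * Real.exp α)) + 1))) ≤
      privateMinimaxRisk.{u} α 0 n t P := by
  refine le_iInf fun 𝔷 => le_iInf fun _ => le_iInf fun Q => le_iInf fun _ => le_iInf fun hQ =>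
    le_iInf fun ℓ => le_iInf fun hℓ => ?_
  have h := meanSquaredError_mixture_lower_bound Q hQ hℓ t hf hg hf0 hg0 hε0 hε1
    (le_iSup₂ (f := fun f (_ : f ∈ P) => meanSquaredError Q ℓ t f) f hfP)
    (le_iSup₂ (f := fun f (_ : f ∈ P) => meanSquaredError Q ℓ t f) _ hmP)
  have hK : 2 * (ENNReal.ofReal (Real.exp (n * (ε ^ 2 * Real.exp α))) + 1) =
      ENNReal.ofReal (2 * (Real.exp (n * (ε ^ 2 * Real.exp α)) + 1)) := by
    rw [ENNReal.ofReal_mul zero_le_two, ENNReal.ofReal_add (Real.exp_pos _).le zero_le_one]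
    simp
  rw [hK] at h
  rw [ENNReal.ofReal_div_of_pos (by positivity)]
  exact ENNReal.div_le_of_le_mul' h

end PrivateDensity

open PrivateDensity in
theorem mainTheorem2 (s : ℝ) (hs : 1 / 2 < s) (L : ℝ) (hL : 0 < L) (α : ℝ) (hα : 0 < α) :
    ∃ C : ℝ, 0 < C ∧ ∀ (t : ℝ) (n : ℕ), 1 ≤ n →
      ENNReal.ofReal (C * (n : ℝ) ^ (-((2 * s - 1) / (2 * s + 1)))) ≤
        PrivateDensity.privateMinimaxRisk.{u} α 0 n t (PrivateDensity.sobolevClass s L) := by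
  set p : ℝ := s + 1 / 2 with hp
  have hp0 : 0 < p := by linarith
  have hΓ : 0 < Real.Gamma p := Real.Gamma_pos_of_pos hp0
  have hπ := Real.pi_pos
  -- `v` is the variance of the null density, `v / (4 n ^ (1 / p))` that of the perturbation,
  -- which is mixed in with weight `ε = (4 ^ p * n) ^ (-1 / 2)`.
  set v : ℝ := (2 * Real.Gamma p / (Real.pi * L ^ 2)) ^ (1 / p) with hvdef
  have hv : 0 < v := by positivity
  -- Equivalently `2 Γ(p) v ^ (-p) = π L²`: the null term takes half of the budget `2 π L²`.
  have hvp : v ^ (-p) = Real.pi * L ^ 2 / (2 * Real.Gamma p) := by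
    rw [hvdef, ← Real.rpow_mul (by positivity), show 1 / p * -p = -1 by field_simp,
      Real.rpow_neg_one, inv_div]
  set K : ℝ := Real.exp ((4 : ℝ) ^ (-p) * Real.exp α) with hK
  -- The numerator is `ε² / (8 π w)` stripped of its power of `n`; `2 (K + 1)` is the two-point
  -- loss.
  refine ⟨(4 : ℝ) ^ (-p) / (2 * Real.pi * v) / (2 * (K + 1)), by positivity, fun t n hn => ?_⟩
  have hn0 : (0 : ℝ) < n := by exact_mod_cast hn
  have hn1 : (1 : ℝ) ≤ n := by exact_mod_cast hn
  set ε : ℝ := √((4 : ℝ) ^ (-p) / n) with hε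
  have hε0 : 0 ≤ ε := Real.sqrt_nonneg _
  have hε2 : ε ^ 2 = (4 : ℝ) ^ (-p) / n := Real.sq_sqrt (by positivity)
  have hε1 : ε ≤ 1 := by
    refine Real.sqrt_le_one.2 ?_
    rw [div_le_one hn0]
    exact (Real.rpow_le_one_of_one_le_of_nonpos (by norm_num) (by linarith)).trans hn1
  set w : ℝ := v / (4 * (n : ℝ) ^ (1 / p)) with hwdef
  have hw : 0 < w := by positivity
  -- The factor `4 ^ (-p)` in `ε²` cancels the 4 in `w`, so the perturbation takes exactly the other
  -- half of the budget.
  have hwp : ε ^ 2 * w ^ (-p) = v ^ (-p) := by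
    rw [hε2, hwdef, Real.div_rpow hv.le (by positivity), Real.mul_rpow (by norm_num) (by positivity),
      ← Real.rpow_mul hn0.le, show 1 / p * -p = -1 by field_simp, Real.rpow_neg_one]
    have : (0 : ℝ) < 4 ^ (-p) := by positivity
    field_simp
  have h4w : 4 * w ≤ v := by
    have : 1 ≤ (n : ℝ) ^ (1 / p) := Real.one_le_rpow hn1 (by positivity)
    rw [hwdef, ← mul_div_assoc, mul_div_mul_left _ _ (four_ne_zero' ℝ)]
    exact div_le_self hv.le this
  have hv0 : (⟨v, hv.le⟩ : NNReal) ≠ 0 := NNReal.coe_ne_zero.1 hv.ne'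
  have hw0 : (⟨w, hw.le⟩ : NNReal) ≠ 0 := NNReal.coe_ne_zero.1 hw.ne'
  -- Used at `δ = 0` for the null density and at `δ = ε` for the alternative.
  have hclass (δ : ℝ) (hδ0 : 0 ≤ δ) (hδε : δ ≤ ε) :
      (fun x => (1 - δ) * gaussianPDFReal t ⟨v, hv.le⟩ x + δ * gaussianPDFReal t ⟨w, hw.le⟩ x) ∈
        sobolevClass s L := by
    refine gaussian_mixture_mem_sobolevClass (by linarith) t hv0 hw0 hδ0
      (hδε.trans hε1) ?_
    change 2 * Real.Gamma p * (v ^ (-p) + δ ^ 2 * w ^ (-p)) ≤ 2 * Real.pi * L ^ 2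
    calc 2 * Real.Gamma p * (v ^ (-p) + δ ^ 2 * w ^ (-p))
        ≤ 2 * Real.Gamma p * (v ^ (-p) + ε ^ 2 * w ^ (-p)) := by gcongr
      _ = 2 * Real.pi * L ^ 2 := by
        rw [hwp, hvp]
        field_simp
        ring
  have hfP := hclass 0 le_rfl hε0
  simp only [sub_zero, one_mul, zero_mul, add_zero] at hfP
  have := isProbabilityMeasure_densityLaw_gaussianPDFReal t hv0
  have := isProbabilityMeasure_densityLaw_gaussianPDFReal t hw0
  refine le_trans (ENNReal.ofReal_le_ofReal ?_) (le_privateMinimaxRisk_of_mixture_mem t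
    (measurable_gaussianPDFReal t ⟨v, hv.le⟩) (measurable_gaussianPDFReal t ⟨w, hw.le⟩)
    (gaussianPDFReal_nonneg t _) (gaussianPDFReal_nonneg t _) hε0 hε1 hfP (hclass ε hε0 le_rfl))
  have hKn : Real.exp (n * (ε ^ 2 * Real.exp α)) = K := by
    rw [hK, hε2]
    congr 1
    field_simp
  have hgap := sq_gaussianPDFReal_sub_lower_bound t (v := ⟨v, hv.le⟩) hw0
    (NNReal.coe_le_coe.1 h4w)
  change 1 / (8 * Real.pi * w) ≤ _ at hgap
  have hrate : (n : ℝ) ^ (-((2 * s - 1) / (2 * s + 1))) = (n : ℝ) ^ (1 / p) / n := by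
    rw [← Real.rpow_sub_one hn0.ne']
    congr 1
    rw [show p = (2 * s + 1) / 2 by rw [hp]; ring]
    have : 2 * s + 1 ≠ 0 := by linarith
    field_simp
    ring
  rw [hKn, mul_pow, div_mul_eq_mul_div]
  refine div_le_div_of_nonneg_right ?_ (by positivity)
  calc (4 : ℝ) ^ (-p) / (2 * Real.pi * v) * (n : ℝ) ^ (-((2 * s - 1) / (2 * s + 1)))
      = ε ^ 2 * (1 / (8 * Real.pi * w)) := by
        rw [hrate, hε2, hwdef]
        field_simp
        norm_num
    _ ≤ _ := by gcongr
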